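/- Let $n\ge 3$, and let $\mathcal E_n$ be the set of exponent $n\times n$ matrices, that is, of the matrices $A=(a_{ij})$ with entries in $\{0,1,2,\dots\}$ such that $a_{ii}=0$ for all $i$ and $a_{ij}+a_{jk}\ge a_{ik}$ for all pairwise distinct $i,j,k\in\{1,\dots,n\}$. On $\mathcal E_n$ let $\odot$ be the entrywise addition, $\oplus$ the entrywise maximum, $0$ the zero matrix, and $\le$ the partial order given by $A\le B$ if and only if $A\oplus B=B$. Then, as subgroups of the group of all bijections $\mathcal E_n\to\mathcal E_n$, $$\mathrm{Aut}(\mathcal E_n,\odot)=\mathrm{Aut}(\mathcal E_n,\oplus)=\mathrm{Aut}(\mathcal E_n,\le)=\mathrm{Aut}(\mathcal E_n,\odot,\oplus,0),$$ and each of these groups is isomorphic to $S_n\times C_2$, where $S_n$ is the symmetric group on $n$ letters and $C_2$ is the cyclic group of order $2$. More precisely, let $S_n\times C_2$ act on $\mathcal E_n$ so that $\sigma\in S_n$ maps $A=(a_{ij})$ to the matrix with $(i,j)$ entry $a_{\sigma^{-1}(i)\sigma^{-1}(j)}$ and the non-trivial element of $C_2$ maps $A$ to its transpose. This action is faithful,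 and the group of bijections of $\mathcal E_n$ that it induces is exactly the automorphism group above. -/

import Mathlib

/-- Exponent matrices: `n × n` matrices over the non-negative integers with zero diagonal and
`a i k ≤ a i j + a j k` for all pairwise distinct `i, j, k`. -/
def IsExponentMatrix {n : ℕ} (A : Matrix (Fin n) (Fin n) ℕ) : Prop :=
  (∀ i, A i i = 0) ∧
    ∀ i j k, i ≠ j → j ≠ k → i ≠ k → A i k ≤ A i j + A j k

/-- The set of all exponent `n × n` matrices. -/
def ExpMat (n : ℕ) : Type := {A : Matrix (Fin n) (Fin n) ℕ // IsExponentMatrix A}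

namespace ExpMat

variable {n : ℕ}

/-- The tropical product `⊙`: entrywise addition. -/
def odot (A B : ExpMat n) : ExpMat n :=
  ⟨A.1 + B.1, by
    refine ⟨fun i => ?_, fun i j k hij hjk hik => ?_⟩
    · simp [A.2.1 i, B.2.1 i]
    · have h₁ := A.2.2 i j k hij hjk hik
      have h₂ := B.2.2 i j k hij hjk hik
      simp only [Matrix.add_apply]
      omega⟩

/-- The tropical sum `⊕`: entrywise maximum. -/
def oplus (A B : ExpMat n) : ExpMat n :=
  ⟨Matrix.of fun i j => max (A.1 i j) (B.1 i j), by
    refine ⟨fun i => ?_, fun i j k hij hjk hik => ?_⟩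
    · simp [A.2.1 i, B.2.1 i]
    · have h₁ := A.2.2 i j k hij hjk hik
      have h₂ := B.2.2 i j k hij hjk hik
      simp only [Matrix.of_apply]
      omega⟩

/-- The zero matrix. -/
def zero (n : ℕ) : ExpMat n :=
  ⟨0, by simp [IsExponentMatrix]⟩

/-- The partial order: `A ≤ B` if and only if `A ⊕ B = B`. -/
def le (A B : ExpMat n) : Prop := oplus A B = B

/-- The transpose. -/
def transpose (A : ExpMat n) : ExpMat n :=
  ⟨A.1.transpose, by
    refine ⟨fun i => A.2.1 i, fun i j k hij hjk hik => ?_⟩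
    have h := A.2.2 k j i hjk.symm hij.symm hik.symm
    simp only [Matrix.transpose_apply]
    omega⟩

/-- Simultaneous permutation of rows and columns: the entry of `A` at `(i, j)` becomes the entry
of `σ · A` at `(σ i, σ j)`. -/
def permute (σ : Equiv.Perm (Fin n)) (A : ExpMat n) : ExpMat n :=
  ⟨Matrix.of fun i j => A.1 (σ⁻¹ i) (σ⁻¹ j), by
    refine ⟨fun i => A.2.1 _, fun i j k hij hjk hik => ?_⟩
    have inj := (σ⁻¹).injective
    exact A.2.2 _ _ _ (inj.ne hij) (inj.ne hjk) (inj.ne hik)⟩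

/-- The action of `S_n × C_2` on exponent matrices: `S_n` permutes rows and columns simultaneously
and the non-trivial element of `C_2` transposes. -/
instance : MulAction (Equiv.Perm (Fin n) × Multiplicative (ZMod 2)) (ExpMat n) where
  smul g A := permute g.1 (if g.2 = 1 then A else transpose A)
  one_smul A := by
    change permute 1 (if (1 : Multiplicative (ZMod 2)) = 1 then A else transpose A) = A
    rw [if_pos rfl]
    rfl
  mul_smul g h A := by
    obtain ⟨σ, c⟩ := g
    obtain ⟨τ, d⟩ := h
    change permute (σ * τ) (if c * d = 1 then A else transpose A) =
      permute σ (if c = 1 then permute τ (if d = 1 then A else transpose A)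
        else transpose (permute τ (if d = 1 then A else transpose A)))
    have key : ∀ c d : Multiplicative (ZMod 2), c * d = 1 ↔ (c = 1 ↔ d = 1) := by decide
    by_cases hc : c = 1 <;> by_cases hd : d = 1 <;> simp only [key, hc, hd] <;> rfl

end ExpMat

/-- The group of automorphisms of a set with a binary operation. -/
def autOp {α : Type*} (f : α → α → α) : Subgroup (Equiv.Perm α) where
  carrier := {φ | ∀ a b, φ (f a b) = f (φ a) (φ b)}
  mul_mem' := by
    intro φ ψ hφ hψ a b
    rw [Equiv.Perm.mul_apply, hψ a b, hφ]
    rfl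
  one_mem' := fun _ _ => rfl
  inv_mem' := by
    intro φ hφ a b
    apply φ.injective
    rw [hφ]
    simp

/-- The group of automorphisms of a set with a binary relation. -/
def autRel {α : Type*} (r : α → α → Prop) : Subgroup (Equiv.Perm α) where
  carrier := {φ | ∀ a b, r a b ↔ r (φ a) (φ b)}
  mul_mem' := fun {_ _} hφ hψ a b => (hψ a b).trans (hφ _ _)
  one_mem' := fun _ _ => Iff.rfl
  inv_mem' := by
    intro φ hφ a b
    have h := hφ (φ⁻¹ a) (φ⁻¹ b)
    simpa using h.symm

namespace ExpMat

/-- `Aut(E_n, ⊙)`. -/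
def autOdot (n : ℕ) : Subgroup (Equiv.Perm (ExpMat n)) := autOp odot

/-- `Aut(E_n, ⊕)`. -/
def autOplus (n : ℕ) : Subgroup (Equiv.Perm (ExpMat n)) := autOp oplus

/-- `Aut(E_n, ≤)`. -/
def autLe (n : ℕ) : Subgroup (Equiv.Perm (ExpMat n)) := autRel le

/-- `Aut(E_n, ⊙, ⊕, 0)`: the bijections that preserve both operations and the zero matrix. -/
def autMaxPlus (n : ℕ) : Subgroup (Equiv.Perm (ExpMat n)) :=
  autOp odot ⊓ autOp oplus ⊓ MulAction.stabilizer (Equiv.Perm (ExpMat n)) (zero n)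

end ExpMat

namespace ExpMat

variable {n : ℕ}

/-! Everything is reduced to the order: order automorphisms preserve joins and conversely, so it
remains to compute `autLe n` and to show that additive automorphisms preserve the order.

For the order, each matrix is the join of the difference matrices of its rows, and an automorphism
fixing the differences of 0-1 functions is the identity (induction on the largest entry,
`map_eq_self_of_le`). The nonzero 0-1 differences are the minimal nonzero elements; they correspond
to the cuts `S` with `∅ ≠ S ≠ univ`, so an automorphism permutes cuts. Below the join of two cuts
lie only those two, their intersection and their union. Counting the `J` for which the pair `I, J`
adds nothing new gives `2 ^ |I| + 2 ^ (n - |I|)`, which singles out the sets of size `1` and `n -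
1`. Hence all singletons go to singletons or all go to complements of singletons; transposition
exchanges the two cases, a permutation of indices then fixes every singleton cut, and this forces
the identity.

For addition, exponent matrices are the lattice points of a cone whose facets are given by the
entries and the triangle defects. Divisibility in the monoid is nonnegativity on facets, so an
additive automorphism permutes the facet functionals (`IsFacet.comp`). Their sum is a multiple of
the sum of entries, which is therefore invariant. The nonzero matrices of least weight do not
distinguish a triangle defect from its reversal, and this prevents an entry from being sent to a
defect (`exists_coord_map`). Entries are thus permuted and the order is preserved. -/

theorem entry_ext {A B : ExpMat n} (h : ∀ i j, A.1 i j = B.1 i j) : A = B :=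
  Subtype.ext (Matrix.ext h)

theorem triangle (A : ExpMat n) (i j k : Fin n) : A.1 i k ≤ A.1 i j + A.1 j k := by
  by_cases hij : i = j
  · subst hij; omega
  by_cases hjk : j = k
  · subst hjk; omega
  by_cases hik : i = k
  · subst hik; rw [A.2.1 i]; omega
  exact A.2.2 i j k hij hjk hik

theorem odot_apply (A B : ExpMat n) (i j : Fin n) : (odot A B).1 i j = A.1 i j + B.1 i j := rfl

theorem oplus_apply (A B : ExpMat n) (i j : Fin n) :
    (oplus A B).1 i j = max (A.1 i j) (B.1 i j) := rfl

theorem zero_apply (i j : Fin n) : (zero n).1 i j = 0 := rfl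

/-! ### The entrywise order and its automorphisms -/

theorem le_iff {A B : ExpMat n} : le A B ↔ ∀ i j, A.1 i j ≤ B.1 i j := by
  constructor
  · intro h i j
    have := congrArg (fun C : ExpMat n => C.1 i j) h
    simp only [oplus_apply] at this
    omega
  · intro h
    exact entry_ext fun i j => by rw [oplus_apply]; exact max_eq_right (h i j)

theorem le_rfl' (A : ExpMat n) : le A A := le_iff.2 fun _ _ => le_rfl

theorem le_antisymm' {A B : ExpMat n} (h : le A B) (h' : le B A) : A = B :=
  entry_ext fun i j => le_antisymm (le_iff.1 h i j) (le_iff.1 h' i j)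

theorem oplus_le_iff {A B C : ExpMat n} : le (oplus A B) C ↔ le A C ∧ le B C := by
  simp only [le_iff, oplus_apply, max_le_iff]
  exact ⟨fun h => ⟨fun i j => (h i j).1, fun i j => (h i j).2⟩, fun h i j => ⟨h.1 i j, h.2 i j⟩⟩

theorem zero_le' (A : ExpMat n) : le (zero n) A := le_iff.2 fun _ _ => Nat.zero_le _

theorem mem_autLe {φ : Equiv.Perm (ExpMat n)} :
    φ ∈ autLe n ↔ ∀ A B, le A B ↔ le (φ A) (φ B) := Iff.rfl

theorem map_oplus_of_mem_autLe {φ : Equiv.Perm (ExpMat n)} (hφ : φ ∈ autLe n) (A B : ExpMat n) :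
    φ (oplus A B) = oplus (φ A) (φ B) := by
  rw [mem_autLe] at hφ
  have key : ∀ C, le (φ (oplus A B)) C ↔ le (oplus (φ A) (φ B)) C := by
    intro C
    obtain ⟨D, rfl⟩ := φ.surjective C
    rw [← hφ, oplus_le_iff, oplus_le_iff, ← hφ, ← hφ]
  exact le_antisymm' ((key _).2 (le_rfl' _)) ((key _).1 (le_rfl' _))

theorem map_zero_of_mem_autLe {φ : Equiv.Perm (ExpMat n)} (hφ : φ ∈ autLe n) :
    φ (zero n) = zero n := by
  refine le_antisymm' ?_ (zero_le' _)
  have := (mem_autLe.1 hφ (zero n) (φ.symm (zero n))).1 (zero_le' _)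
  simpa using this

/-! ### Difference matrices generate under joins; rigidity by induction on the entries -/

/-- The exponent matrix of truncated differences of a function. -/
def diff (u : Fin n → ℕ) : ExpMat n :=
  ⟨Matrix.of fun k l => u l - u k, by
    refine ⟨fun i => Nat.sub_self _, fun i j k _ _ _ => ?_⟩
    simp only [Matrix.of_apply]
    omega⟩

theorem diff_apply (u : Fin n → ℕ) (k l : Fin n) : (diff u).1 k l = u l - u k := rfl

/-- This is the triangle inequality through `k`, read as a lower bound for the entry at `(k, l)`.
Together with `diff_row_apply` it makes every matrix the join of the differences of its rows. -/
theorem diff_row_le (A : ExpMat n) (i : Fin n) : le (diff (A.1 i)) A := by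
  refine le_iff.2 fun k l => ?_
  have := A.triangle i k l
  rw [diff_apply]
  omega

theorem diff_row_apply (A : ExpMat n) (i j : Fin n) : (diff (A.1 i)).1 i j = A.1 i j := by
  rw [diff_apply, A.2.1 i, Nat.sub_zero]

theorem le_of_forall_diff_row_le {A B : ExpMat n} (h : ∀ i, le (diff (A.1 i)) B) : le A B :=
  le_iff.2 fun i j => by
    rw [← diff_row_apply A i j]
    exact le_iff.1 (h i) i j

/-- A matrix below `diff u` which reaches an entry bounding `u` equals `diff u`. -/
theorem eq_diff_of_le {D : ExpMat n} {u : Fin n → ℕ} {m : ℕ} (hu : ∀ i, u i ≤ m)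
    (hD : le D (diff u)) {i j : Fin n} (hij : m ≤ D.1 i j) : D = diff u := by
  refine le_antisymm' hD (le_iff.2 fun k l => ?_)
  have h := le_iff.1 hD
  simp only [diff_apply] at h ⊢
  -- The bounds force `u i = 0` and `u j = m`. The path `i, k, l, j` then gives `m ≤ u k + D k l +
  -- (m - u l)`, which is the required lower bound on `D k l`.
  have h1 := h i j
  have h2 := h i k
  have h3 := h l j
  have h4 := D.triangle i k j
  have h5 := D.triangle k l j
  have := hu i
  have := hu j
  have := hu k
  have := hu l
  omega

/-- Entrywise truncation at `m`. -/
def trunc (m : ℕ) (A : ExpMat n) : ExpMat n :=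
  ⟨Matrix.of fun k l => min (A.1 k l) m, by
    refine ⟨fun i => by simp [A.2.1 i], fun i j k _ _ _ => ?_⟩
    have := A.triangle i j k
    simp only [Matrix.of_apply]
    omega⟩

theorem trunc_apply (m : ℕ) (A : ExpMat n) (k l : Fin n) :
    (trunc m A).1 k l = min (A.1 k l) m := rfl

theorem trunc_le (m : ℕ) (A : ExpMat n) : le (trunc m A) A :=
  le_iff.2 fun _ _ => min_le_left _ _

theorem map_eq_self_of_forall_diff_row {φ : Equiv.Perm (ExpMat n)} (hφ : φ ∈ autLe n)
    {A : ExpMat n} (h : ∀ i, φ (diff (A.1 i)) = diff (A.1 i)) : φ A = A := by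
  refine le_antisymm' ?_ ?_
  · have h1 : le A (φ.symm A) := by
      refine le_of_forall_diff_row_le fun i => ?_
      rw [mem_autLe.1 hφ, φ.apply_symm_apply, h]
      exact diff_row_le A i
    rwa [mem_autLe.1 hφ, φ.apply_symm_apply] at h1
  · refine le_of_forall_diff_row_le fun i => ?_
    rw [← h i, ← mem_autLe.1 hφ]
    exact diff_row_le A i

/-- Two difference matrices with upper bound `m + 2`, attained by both, that have the same
truncation at `m + 1` are equal. -/
theorem diff_eq_of_trunc_eq {u v : Fin n → ℕ} {m : ℕ} (hu : ∀ i, u i ≤ m + 2)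
    (hv : ∀ k l, (diff v).1 k l ≤ m + 2) {i j : Fin n} (hi : u i = 0) (hj : u j = m + 2)
    {p q : Fin n} (hp : (diff v).1 p q = m + 2)
    (h : trunc (m + 1) (diff u) = trunc (m + 1) (diff v)) : diff u = diff v := by
  have h' : ∀ k l, min (u l - u k) (m + 1) = min (v l - v k) (m + 1) := fun k l =>
    congrArg (fun C : ExpMat n => C.1 k l) h
  simp only [diff_apply] at hv hp
  have hvi : ∀ l, v i ≤ v l := fun l => by
    have := h' l i
    omega
  have hmin : ∀ l, min (u l) (m + 1) = min (v l - v i) (m + 1) := fun l => by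
    have := h' i l
    rwa [hi, Nat.sub_zero] at this
  have hq : v q = v i + (m + 2) := by
    have := hv i q
    have := hvi p
    omega
  -- Truncation can only confuse the heights `m + 1` and `m + 2`. If they were confused at `l`,
  -- comparing `l` with the top index `j` of `u`, or `q` of `v`, shows a further rise of at least
  -- one above `m + 2`.
  have key : ∀ l, u l = v l - v i := fun l => by
    have h1 := hmin l
    rcases lt_trichotomy (u l) (v l - v i) with h2 | h2 | h2
    · have h3 := h' l j
      have h4 := hv i l
      have h5 := hv i j
      rw [hj] at h3
      omega
    · exact h2
    · have h3 := h' l q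
      have h4 := hu l
      have h5 := hu q
      rw [hq] at h3
      omega
  refine entry_ext fun k l => ?_
  have := key k
  have := key l
  have := hvi k
  have := hvi l
  simp only [diff_apply]
  omega

/-- By the row decomposition it suffices to fix `diff u` with minimum `0` and maximum `m + 2`.
Everything strictly below it has smaller entries and is fixed by induction. A different image would
still be a row difference with maximal entry `m + 2` and the same truncation at `m + 1`,
contradicting `diff_eq_of_trunc_eq`. -/
theorem map_eq_self_of_le {φ : Equiv.Perm (ExpMat n)} (hφ : φ ∈ autLe n)
    (h : ∀ u : Fin n → ℕ, (∀ i, u i ≤ 1) → φ (diff u) = diff u) (m : ℕ) :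
    ∀ A : ExpMat n, (∀ i j, A.1 i j ≤ m + 1) → φ A = A := by
  induction m with
  | zero => exact fun A hA => map_eq_self_of_forall_diff_row hφ fun i => h _ (hA i)
  | succ m ih =>
    intro A hA
    refine map_eq_self_of_forall_diff_row hφ fun i => ?_
    have hu := hA i
    have hi := A.2.1 i
    generalize A.1 i = u at hu hi
    by_cases hex : ∃ j, u j = m + 2
    swap
    · refine ih _ fun k l => ?_
      have h1 := hu l
      have h2 : u l ≠ m + 2 := fun h2 => hex ⟨l, h2⟩
      rw [diff_apply]
      omega
    obtain ⟨j, hj⟩ := hex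
    have hlow : ∀ D, le D (diff u) → D ≠ diff u → ∀ k l, D.1 k l ≤ m + 1 := by
      intro D hD hne k l
      by_contra hlt
      exact hne (eq_diff_of_le hu hD (i := k) (j := l) (by omega))
    by_contra hne
    have hfix : ∀ D, le D (φ (diff u)) → D ≠ φ (diff u) → le D (diff u) ∧ D ≠ diff u := by
      intro D hD hD'
      have h1 : le (φ.symm D) (diff u) := by rwa [mem_autLe.1 hφ, φ.apply_symm_apply]
      have h2 : φ.symm D ≠ diff u := fun h2 => hD' (by rw [← h2, φ.apply_symm_apply])
      have h3 := ih _ (hlow _ h1 h2)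
      rw [φ.apply_symm_apply] at h3
      rw [h3]
      exact ⟨h1, h2⟩
    -- Otherwise every row difference lies strictly below the image, hence below `diff u`; the image
    -- is then strictly below `diff u`, so it is already fixed, against injectivity.
    have hrow : ∃ k, diff ((φ (diff u)).1 k) = φ (diff u) := by
      by_contra hno
      push Not at hno
      have h1 : le (φ (diff u)) (diff u) := le_of_forall_diff_row_le fun k =>
        (hfix _ (diff_row_le _ k) (hno k)).1
      have h2 := ih _ (hlow _ h1 hne)
      exact hne (φ.injective h2)
    -- Truncating an image with too large an entry would give a matrix strictly below `diff u` that
    -- still reaches `m + 2`.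
    have hbd : ∀ k l, (φ (diff u)).1 k l ≤ m + 2 := by
      by_contra hno
      push Not at hno
      obtain ⟨k, l, hkl⟩ := hno
      obtain ⟨h1, h2⟩ := hfix (trunc (m + 2) (φ (diff u))) (trunc_le _ _) (fun h3 => by
        have := congrArg (fun C : ExpMat n => C.1 k l) h3
        simp only [trunc_apply] at this
        omega)
      have := hlow _ h1 h2 k l
      rw [trunc_apply] at this
      omega
    have htr : trunc (m + 1) (diff u) = trunc (m + 1) (φ (diff u)) := by
      have hT : ∀ B : ExpMat n, φ (trunc (m + 1) B) = trunc (m + 1) B := fun B =>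
        ih _ fun k l => by rw [trunc_apply]; exact min_le_right _ _
      have aux : ∀ B C : ExpMat n, le (trunc (m + 1) B) C →
          le (trunc (m + 1) B) (trunc (m + 1) C) := by
        intro B C hBC
        refine le_iff.2 fun k l => ?_
        have := le_iff.1 hBC k l
        simp only [trunc_apply] at this ⊢
        omega
      refine le_antisymm' (aux _ _ ?_) (aux _ _ ?_)
      · rw [← hT, ← mem_autLe.1 hφ]
        exact trunc_le _ _
      · rw [mem_autLe.1 hφ, hT]
        exact trunc_le _ _
    obtain ⟨p, q, hp⟩ : ∃ p q, (φ (diff u)).1 p q = m + 2 := by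
      by_contra hno
      push Not at hno
      have h1 := ih (φ (diff u)) fun k l => by
        have := hno k l
        have := hbd k l
        omega
      exact hne (φ.injective h1)
    obtain ⟨k, hk⟩ := hrow
    rw [← hk] at hbd htr hne hp
    exact hne (diff_eq_of_trunc_eq hu hbd hi hj hp htr).symm

theorem exists_entry_bound (A : ExpMat n) : ∃ M : ℕ, ∀ i j, A.1 i j ≤ M := by
  refine ⟨∑ i, ∑ j, A.1 i j, fun i j => ?_⟩
  exact (Finset.single_le_sum (f := fun j => A.1 i j) (fun _ _ => Nat.zero_le _)
    (Finset.mem_univ j)).trans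
    (Finset.single_le_sum (f := fun i => ∑ j, A.1 i j) (fun _ _ => Nat.zero_le _)
      (Finset.mem_univ i))

/-- An order automorphism that fixes all difference matrices of `0`-`1` functions is trivial. -/
theorem eq_one_of_map_diff {φ : Equiv.Perm (ExpMat n)} (hφ : φ ∈ autLe n)
    (h : ∀ u : Fin n → ℕ, (∀ i, u i ≤ 1) → φ (diff u) = diff u) : φ = 1 := by
  ext1 A
  obtain ⟨M, hM⟩ := exists_entry_bound A
  exact map_eq_self_of_le hφ h M A fun i j => (hM i j).trans (Nat.le_succ M)

/-! ### Cut matrices as the minimal nonzero elements -/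

/-- The `0`-`1` matrix with ones exactly at the entries `(k, l)` with `k ∉ S` and `l ∈ S`. -/
def atom (S : Finset (Fin n)) : ExpMat n := diff fun i => if i ∈ S then 1 else 0

theorem atom_apply (S : Finset (Fin n)) (k l : Fin n) :
    (atom S).1 k l = if l ∈ S ∧ k ∉ S then 1 else 0 := by
  rw [atom, diff_apply]
  by_cases hl : l ∈ S <;> by_cases hk : k ∈ S <;> simp [hl, hk]

theorem atom_le_iff {S : Finset (Fin n)} {A : ExpMat n} :
    le (atom S) A ↔ ∀ k l, k ∉ S → l ∈ S → 0 < A.1 k l := by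
  rw [le_iff]
  refine forall₂_congr fun k l => ?_
  rw [atom_apply]
  by_cases hl : l ∈ S <;> by_cases hk : k ∈ S <;> simp [hl, hk, Nat.succ_le_iff]

theorem atom_empty : atom (∅ : Finset (Fin n)) = zero n :=
  entry_ext fun k l => by simp [atom_apply, zero_apply]

theorem atom_univ : atom (Finset.univ : Finset (Fin n)) = zero n :=
  entry_ext fun k l => by simp [atom_apply, zero_apply]

theorem eq_of_atom_le_atom {S T : Finset (Fin n)} (h : le (atom S) (atom T)) :
    S = ∅ ∨ S = Finset.univ ∨ S = T := by
  have h' : ∀ k l, k ∉ S → l ∈ S → l ∈ T ∧ k ∉ T := by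
    intro k l hk hl
    have := atom_le_iff.1 h k l hk hl
    rw [atom_apply] at this
    by_contra hno
    rw [if_neg hno] at this
    exact lt_irrefl 0 this
  by_contra! hno
  obtain ⟨h0, h1, h2⟩ := hno
  obtain ⟨i, hi⟩ := h0
  obtain ⟨j, hj⟩ : ∃ j, j ∉ S := by
    by_contra! hall
    exact h1 (Finset.eq_univ_of_forall hall)
  refine h2 (Finset.ext fun l => ⟨fun hl => (h' j l hj hl).1, fun hl => ?_⟩)
  by_contra hl'
  exact (h' l i hl' hi).2 hl

theorem atom_eq_zero_iff {S : Finset (Fin n)} :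
    atom S = zero n ↔ S = ∅ ∨ S = Finset.univ := by
  constructor
  · intro h
    have : le (atom S) (atom ∅) := by rw [h]; exact zero_le' _
    rcases eq_of_atom_le_atom this with h | h | h
    · exact Or.inl h
    · exact Or.inr h
    · exact Or.inl h
  · rintro (rfl | rfl)
    exacts [atom_empty, atom_univ]

theorem eq_zero_or_eq_atom_of_le {D : ExpMat n} {S : Finset (Fin n)} (h : le D (atom S)) :
    D = zero n ∨ D = atom S := by
  by_cases h0 : ∃ i j, 1 ≤ D.1 i j
  · obtain ⟨i, j, hij⟩ := h0
    refine Or.inr (eq_diff_of_le (m := 1) (fun i => ?_) h hij)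
    split_ifs <;> simp
  · push Not at h0
    exact Or.inl (entry_ext fun i j => by rw [zero_apply]; have := h0 i j; omega)

theorem exists_atom_le {A : ExpMat n} (hA : A ≠ zero n) :
    ∃ S, atom S ≠ zero n ∧ le (atom S) A := by
  obtain ⟨p, q, hpq⟩ : ∃ p q, 0 < A.1 p q := by
    by_contra! h0
    exact hA (entry_ext fun i j => Nat.le_zero.1 (h0 i j))
  -- The cut is the support of row `p`: if `A p k = 0 < A p l`, the triangle inequality gives `0 < A
  -- k l`.
  refine ⟨Finset.univ.filter fun l => 0 < A.1 p l, ?_, atom_le_iff.2 fun k l hk hl => ?_⟩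
  · rw [Ne, atom_eq_zero_iff, not_or]
    constructor
    · intro h
      have : q ∈ (∅ : Finset (Fin n)) := by rw [← h]; simpa using hpq
      simp at this
    · intro h
      have : p ∈ (Finset.univ : Finset (Fin n)) := Finset.mem_univ p
      rw [← h] at this
      simp [A.2.1 p] at this
  · simp only [Finset.mem_filter, Finset.mem_univ, true_and] at hk hl
    have := A.triangle p k l
    omega

theorem exists_map_atom {φ : Equiv.Perm (ExpMat n)} (hφ : φ ∈ autLe n) (S : Finset (Fin n)) :
    ∃ T, φ (atom S) = atom T := by
  by_cases hS : atom S = zero n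
  · exact ⟨S, by rw [hS, map_zero_of_mem_autLe hφ]⟩
  have hne : φ (atom S) ≠ zero n := by
    rw [← map_zero_of_mem_autLe hφ]
    exact φ.injective.ne hS
  obtain ⟨T, hT, hle⟩ := exists_atom_le hne
  refine ⟨T, ?_⟩
  have h1 : le (φ.symm (atom T)) (atom S) := by rwa [mem_autLe.1 hφ, φ.apply_symm_apply]
  rcases eq_zero_or_eq_atom_of_le h1 with h2 | h2
  · rw [Equiv.symm_apply_eq, map_zero_of_mem_autLe hφ] at h2
    exact absurd h2 hT
  · rw [← h2, φ.apply_symm_apply]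

theorem atom_injective_of_ne {S T : Finset (Fin n)} (h0 : S ≠ ∅) (h1 : S ≠ Finset.univ)
    (h : atom S = atom T) : S = T := by
  rcases eq_of_atom_le_atom (h ▸ le_rfl' (atom S) : le (atom S) (atom T)) with h2 | h2 | h2
  exacts [absurd h2 h0, absurd h2 h1, h2]

theorem exists_map_atom_fun {φ : Equiv.Perm (ExpMat n)} (hφ : φ ∈ autLe n) :
    ∃ f : Finset (Fin n) → Finset (Fin n), f ∅ = ∅ ∧ f Finset.univ = Finset.univ ∧
      ∀ S, φ (atom S) = atom (f S) := by
  choose f hf using exists_map_atom hφ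
  -- `∅` and `univ` both give the zero matrix, so the map on sets is not determined there; fixing
  -- both makes it a bijection.
  refine ⟨fun S => if S = ∅ ∨ S = Finset.univ then S else f S, by simp, by simp, fun S => ?_⟩
  by_cases hS : S = ∅ ∨ S = Finset.univ
  · beta_reduce
    rw [if_pos hS, atom_eq_zero_iff.2 hS, map_zero_of_mem_autLe hφ]
  · beta_reduce
    rw [if_neg hS, hf]

/-- An order automorphism permutes the atoms. -/
theorem exists_perm_map_atom {φ : Equiv.Perm (ExpMat n)} (hφ : φ ∈ autLe n) :
    ∃ F : Equiv.Perm (Finset (Fin n)), F ∅ = ∅ ∧ F Finset.univ = Finset.univ ∧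
      ∀ S, φ (atom S) = atom (F S) := by
  obtain ⟨f, hf0, hf1, hf⟩ := exists_map_atom_fun hφ
  obtain ⟨g, hg0, hg1, hg⟩ := exists_map_atom_fun (inv_mem hφ)
  have hgf : ∀ S, g (f S) = S := by
    intro S
    by_cases h0 : S = ∅
    · rw [h0, hf0, hg0]
    by_cases h1 : S = Finset.univ
    · rw [h1, hf1, hg1]
    refine (atom_injective_of_ne h0 h1 ?_).symm
    rw [← hg, ← hf, Equiv.Perm.inv_def, Equiv.symm_apply_apply]
  have hfg : ∀ S, f (g S) = S := by
    intro S
    by_cases h0 : S = ∅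
    · rw [h0, hg0, hf0]
    by_cases h1 : S = Finset.univ
    · rw [h1, hg1, hf1]
    refine (atom_injective_of_ne h0 h1 ?_).symm
    rw [← hf, ← hg, Equiv.Perm.inv_def, Equiv.apply_symm_apply]
  exact ⟨⟨f, g, hgf, hfg⟩, hf0, hf1, hf⟩

/-! ### Joins of two cuts and the recognition of singletons -/

theorem atom_le_oplus_iff {I J K : Finset (Fin n)} :
    le (atom K) (oplus (atom I) (atom J)) ↔
      ∀ k l, k ∉ K → l ∈ K → (l ∈ I ∧ k ∉ I) ∨ (l ∈ J ∧ k ∉ J) := by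
  rw [atom_le_iff]
  refine forall₂_congr fun k l => ?_
  rw [oplus_apply, atom_apply, atom_apply]
  by_cases h1 : l ∈ I ∧ k ∉ I <;> by_cases h2 : l ∈ J ∧ k ∉ J <;> simp [h1, h2]

theorem atom_inter_le (I J : Finset (Fin n)) :
    le (atom (I ∩ J)) (oplus (atom I) (atom J)) := by
  rw [atom_le_oplus_iff]
  intro k l hk hl
  rw [Finset.mem_inter] at hk hl
  tauto

theorem atom_union_le (I J : Finset (Fin n)) :
    le (atom (I ∪ J)) (oplus (atom I) (atom J)) := by
  rw [atom_le_oplus_iff]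
  intro k l hk hl
  rw [Finset.mem_union] at hk hl
  tauto

/-- An element of `K` outside `I` can be separated from the points outside `K` only by `J`, so `K ⊄
I` forces `J ⊆ K`, and symmetrically. The four outcomes are the four combinations of `K ⊆ I` and `K
⊆ J`. -/
theorem eq_of_atom_le_oplus {I J K : Finset (Fin n)}
    (h : le (atom K) (oplus (atom I) (atom J))) (h0 : K ≠ ∅) (h1 : K ≠ Finset.univ) :
    K = I ∨ K = J ∨ K = I ∩ J ∨ K = I ∪ J := by
  rw [atom_le_oplus_iff] at h
  obtain ⟨x, hx⟩ := Finset.nonempty_iff_ne_empty.2 h0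
  obtain ⟨y, hy⟩ : ∃ y, y ∉ K := by
    by_contra! hall
    exact h1 (Finset.eq_univ_of_forall hall)
  have hKI : ¬ K ⊆ I → J ⊆ K := by
    intro hK z hz
    obtain ⟨w, hw, hw'⟩ := Finset.not_subset.1 hK
    by_contra hz'
    rcases h z w hz' hw with h2 | h2
    exacts [hw' h2.1, h2.2 hz]
  have hKJ : ¬ K ⊆ J → I ⊆ K := by
    intro hK z hz
    obtain ⟨w, hw, hw'⟩ := Finset.not_subset.1 hK
    by_contra hz'
    rcases h z w hz' hw with h2 | h2
    exacts [h2.2 hz, hw' h2.1]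
  by_cases hI : K ⊆ I <;> by_cases hJ : K ⊆ J
  · right; right; left
    refine Finset.Subset.antisymm (Finset.subset_inter hI hJ) fun z hz => ?_
    rw [Finset.mem_inter] at hz
    by_contra hz'
    rcases h z x hz' hx with h2 | h2
    exacts [h2.2 hz.1, h2.2 hz.2]
  · exact Or.inl (Finset.Subset.antisymm hI (hKJ hJ))
  · exact Or.inr (Or.inl (Finset.Subset.antisymm hJ (hKI hI)))
  · right; right; right
    refine Finset.Subset.antisymm (fun z hz => ?_) (Finset.union_subset (hKJ hJ) (hKI hI))
    rw [Finset.mem_union]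
    rcases h y z hy hz with h2 | h2
    exacts [Or.inl h2.1, Or.inr h2.1]

/-- Only the atoms of `I` and `J` lie below their join. -/
def Thin (I J : Finset (Fin n)) : Prop :=
  ∀ K, le (atom K) (oplus (atom I) (atom J)) → K = ∅ ∨ K = Finset.univ ∨ K = I ∨ K = J

/-- The cuts of `I ∩ J` and `I ∪ J` always lie below the join, so they must be trivial or equal to
`I` or `J`; `eq_of_atom_le_oplus` shows that nothing else can lie there. -/
theorem thin_iff {I J : Finset (Fin n)} : Thin I J ↔ J ⊆ I ∨ I ⊆ J ∨ J = Iᶜ := by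
  constructor
  · intro h
    have h1 := h _ (atom_inter_le I J)
    have h2 := h _ (atom_union_le I J)
    rw [Finset.inter_eq_left, Finset.inter_eq_right] at h1
    rw [Finset.union_eq_left, Finset.union_eq_right] at h2
    rcases h1 with h1 | h1 | h1 | h1
    · rcases h2 with h2 | h2 | h2 | h2
      · rw [Finset.union_eq_empty] at h2
        rw [h2.1]; simp
      · right; right
        exact (IsCompl.of_eq h1 h2).compl_eq.symm
      · exact Or.inl h2
      · exact Or.inr (Or.inl h2)
    · left
      rw [Finset.eq_univ_iff_forall] at h1
      exact fun z _ => (Finset.mem_inter.1 (h1 z)).1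
    · exact Or.inr (Or.inl h1)
    · exact Or.inl h1
  · intro h K hK
    by_cases h0 : K = ∅
    · exact Or.inl h0
    by_cases h1 : K = Finset.univ
    · exact Or.inr (Or.inl h1)
    have h2 := eq_of_atom_le_oplus hK h0 h1
    rcases h with h | h | rfl
    · rw [Finset.inter_eq_right.2 h, Finset.union_eq_left.2 h] at h2
      tauto
    · rw [Finset.inter_eq_left.2 h, Finset.union_eq_right.2 h] at h2
      tauto
    · rw [Finset.inter_compl, Finset.union_compl] at h2
      tauto

open scoped Classical in
-- Subsets and supersets of `I` overlap only in `I`, and the loss of one there is made up by `Iᶜ`.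
theorem card_filter_thin {I : Finset (Fin n)} (h0 : I ≠ ∅) (h1 : I ≠ Finset.univ) :
    (Finset.univ.filter fun J => Thin I J).card = 2 ^ I.card + 2 ^ (n - I.card) := by
  have hset : (Finset.univ.filter fun J => Thin I J) =
      insert Iᶜ (Finset.Iic I ∪ Finset.Ici I) := by
    ext J
    simp only [Finset.mem_filter, Finset.mem_univ, true_and, thin_iff, Finset.mem_insert,
      Finset.mem_union, Finset.mem_Iic, Finset.mem_Ici]
    tauto
  have hnot : Iᶜ ∉ Finset.Iic I ∪ Finset.Ici I := by
    simp only [Finset.mem_union, Finset.mem_Iic, Finset.mem_Ici]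
    rintro (h | h)
    · exact h1 (by simpa using compl_le_self.1 h)
    · exact h0 (by simpa using le_compl_self.1 h)
  have hinter : Finset.Iic I ∩ Finset.Ici I = {I} := by
    ext J
    simp only [Finset.mem_inter, Finset.mem_Iic, Finset.mem_Ici, Finset.mem_singleton]
    exact ⟨fun h => le_antisymm h.1 h.2, fun h => by simp [h]⟩
  have hIci : (Finset.Ici I).card = 2 ^ (n - I.card) := by
    have : Finset.Ici I = Finset.Icc I Finset.univ := by
      ext J; simp
    rw [this, Finset.card_Icc_finset (Finset.subset_univ I), Finset.card_univ, Fintype.card_fin]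
  have hcard := Finset.card_union_add_card_inter (Finset.Iic I) (Finset.Ici I)
  rw [hinter, Finset.card_singleton, Finset.card_Iic_finset, hIci] at hcard
  rw [hset, Finset.card_insert_of_notMem hnot, hcard]

theorem eq_one_or_of_two_pow_add {n t : ℕ} (ht : 1 ≤ t) (htn : t + 1 ≤ n)
    (h : 2 ^ t + 2 ^ (n - t) = 2 ^ 1 + 2 ^ (n - 1)) : t = 1 ∨ t = n - 1 := by
  obtain ⟨a, rfl⟩ : ∃ a, t = a + 1 := ⟨t - 1, by omega⟩
  obtain ⟨b, rfl⟩ : ∃ b, n = a + 1 + (b + 1) := ⟨n - a - 2, by omega⟩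
  have e1 : a + 1 + (b + 1) - (a + 1) = b + 1 := by omega
  have e2 : a + 1 + (b + 1) - 1 = a + b + 1 := by omega
  rw [e1, e2, pow_succ, pow_succ, pow_succ _ (a + b), pow_add] at h
  have ha : 1 ≤ 2 ^ a := Nat.one_le_two_pow
  have hb : 1 ≤ 2 ^ b := Nat.one_le_two_pow
  -- Halving the hypothesis gives `2 ^ a + 2 ^ b = 1 + 2 ^ (a + b)`, which factors.
  have hprod : (2 ^ a - 1 : ℤ) * (2 ^ b - 1) = 0 := by
    zify at h
    linarith
  rcases mul_eq_zero.1 hprod with h' | h'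
  · left
    rcases Nat.eq_zero_or_pos a with h0 | h0
    · omega
    · have := Nat.one_lt_two_pow h0.ne'
      zify at this
      linarith
  · right
    rcases Nat.eq_zero_or_pos b with h0 | h0
    · omega
    · have := Nat.one_lt_two_pow h0.ne'
      zify at this
      linarith

theorem thin_map_iff {φ : Equiv.Perm (ExpMat n)} (hφ : φ ∈ autLe n)
    {F : Equiv.Perm (Finset (Fin n))} (hF0 : F ∅ = ∅) (hF1 : F Finset.univ = Finset.univ)
    (hF : ∀ S, φ (atom S) = atom (F S)) (I J : Finset (Fin n)) :
    Thin (F I) (F J) ↔ Thin I J := by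
  rw [Thin, Thin, F.surjective.forall]
  refine forall_congr' fun K => ?_
  rw [← hF, ← hF, ← hF, ← map_oplus_of_mem_autLe hφ, ← mem_autLe.1 hφ]
  rw [F.injective.eq_iff, F.injective.eq_iff]
  nth_rw 1 [← hF0]
  nth_rw 1 [← hF1]
  rw [F.injective.eq_iff, F.injective.eq_iff]

open scoped Classical in
theorem card_filter_thin_map {φ : Equiv.Perm (ExpMat n)} (hφ : φ ∈ autLe n)
    {F : Equiv.Perm (Finset (Fin n))} (hF0 : F ∅ = ∅) (hF1 : F Finset.univ = Finset.univ)
    (hF : ∀ S, φ (atom S) = atom (F S)) (I : Finset (Fin n)) :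
    (Finset.univ.filter fun J => Thin (F I) J).card =
      (Finset.univ.filter fun J => Thin I J).card := by
  symm
  refine Finset.card_bij (fun J _ => F J) ?_ (fun _ _ _ _ h => F.injective h) ?_
  · intro J hJ
    simpa [thin_map_iff hφ hF0 hF1 hF] using hJ
  · intro J hJ
    refine ⟨F.symm J, ?_, F.apply_symm_apply J⟩
    rw [Finset.mem_filter] at hJ ⊢
    rw [← thin_map_iff hφ hF0 hF1 hF, F.apply_symm_apply]
    exact ⟨Finset.mem_univ _, hJ.2⟩

theorem singleton_ne_univ (hn : 3 ≤ n) (i : Fin n) :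
    ({i} : Finset (Fin n)) ≠ Finset.univ := by
  intro h
  have := congrArg Finset.card h
  rw [Finset.card_singleton, Finset.card_univ, Fintype.card_fin] at this
  omega

theorem map_singleton {φ : Equiv.Perm (ExpMat n)} (hn : 3 ≤ n) (hφ : φ ∈ autLe n)
    {F : Equiv.Perm (Finset (Fin n))} (hF0 : F ∅ = ∅) (hF1 : F Finset.univ = Finset.univ)
    (hF : ∀ S, φ (atom S) = atom (F S)) (i : Fin n) :
    (∃ a, F {i} = {a}) ∨ ∃ a, F {i} = {a}ᶜ := by
  classical
  have hi0 : ({i} : Finset (Fin n)) ≠ ∅ := Finset.singleton_ne_empty i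
  have hi1 := singleton_ne_univ hn i
  have h0 : F {i} ≠ ∅ := by rw [← hF0]; exact F.injective.ne hi0
  have h1 : F {i} ≠ Finset.univ := by rw [← hF1]; exact F.injective.ne hi1
  have h := card_filter_thin_map hφ hF0 hF1 hF {i}
  rw [card_filter_thin h0 h1, card_filter_thin hi0 hi1, Finset.card_singleton] at h
  have hpos : 1 ≤ (F {i}).card := Finset.card_pos.2 (Finset.nonempty_iff_ne_empty.2 h0)
  have hlt : (F {i}).card < n := by
    have := Finset.card_lt_card (Finset.ssubset_univ_iff.2 h1)
    rwa [Finset.card_univ, Fintype.card_fin] at this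
  rcases eq_one_or_of_two_pow_add hpos hlt h with h2 | h2
  · exact Or.inl (Finset.card_eq_one.1 h2)
  · right
    have : (F {i})ᶜ.card = 1 := by
      rw [Finset.card_compl, Fintype.card_fin]
      omega
    obtain ⟨a, ha⟩ := Finset.card_eq_one.1 this
    exact ⟨a, by rw [← ha, compl_compl]⟩

theorem not_thin_singleton (hn : 3 ≤ n) {i j : Fin n} (hij : i ≠ j) :
    ¬ Thin ({i} : Finset (Fin n)) {j} := by
  rw [thin_iff]
  rintro (h | h | h)
  · exact hij (Finset.mem_singleton.1 (Finset.singleton_subset_iff.1 h)).symm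
  · exact hij (Finset.mem_singleton.1 (Finset.singleton_subset_iff.1 h))
  · have := congrArg Finset.card h
    rw [Finset.card_compl, Finset.card_singleton, Finset.card_singleton, Fintype.card_fin] at this
    omega

theorem thin_singleton_compl (a b : Fin n) : Thin ({a} : Finset (Fin n)) {b}ᶜ := by
  rw [thin_iff]
  by_cases h : a = b
  · subst h; simp
  · right; left
    simpa using Ne.symm h

/-- The two types cannot mix: distinct singletons are not thin when `n ≥ 3`, whereas a singleton and
the complement of a singleton always are. -/
theorem forall_map_singleton {φ : Equiv.Perm (ExpMat n)} (hn : 3 ≤ n) (hφ : φ ∈ autLe n) :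
    (∀ i, ∃ a, φ (atom {i}) = atom {a}) ∨ ∀ i, ∃ a, φ (atom {i}) = atom {a}ᶜ := by
  obtain ⟨F, hF0, hF1, hF⟩ := exists_perm_map_atom hφ
  have key : ∀ i j a b, F {i} = {a} → F {j} = {b}ᶜ → i = j := by
    intro i j a b hi hj
    by_contra hij
    refine not_thin_singleton hn hij ?_
    rw [← thin_map_iff hφ hF0 hF1 hF, hi, hj]
    exact thin_singleton_compl a b
  by_cases hall : ∀ i, ∃ a, F {i} = {a}
  · left
    intro i
    obtain ⟨a, ha⟩ := hall i
    exact ⟨a, by rw [hF, ha]⟩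
  · right
    push Not at hall
    obtain ⟨j, hj⟩ := hall
    obtain ⟨b, hb⟩ := (map_singleton hn hφ hF0 hF1 hF j).resolve_left fun ⟨a, ha⟩ => hj a ha
    intro i
    obtain ⟨a, ha⟩ : ∃ a, F {i} = {a}ᶜ := by
      rcases map_singleton hn hφ hF0 hF1 hF i with ⟨a, ha⟩ | h
      · obtain rfl := key i j a b ha hb
        exact absurd ha (hj a)
      · exact h
    exact ⟨a, by rw [hF, ha]⟩

/-- An order automorphism that fixes the atoms of the singletons is trivial. -/
theorem eq_one_of_map_singleton {φ : Equiv.Perm (ExpMat n)} (hφ : φ ∈ autLe n)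
    (h : ∀ i, φ (atom {i}) = atom {i}) : φ = 1 := by
  obtain ⟨F, hF0, hF1, hF⟩ := exists_perm_map_atom hφ
  have hatom : ∀ S, φ (atom S) = atom S := by
    intro S
    induction S using Finset.induction_on with
    | empty => rw [hF, hF0]
    | insert i S hi ih =>
      by_cases hu : insert i S = Finset.univ
      · rw [hF, hu, hF1]
      -- The image of the cut of `{i} ∪ S` is a cut below the same fixed join, so few candidates
      -- remain. If it is the cut of `{i}` or of `S`, injectivity identifies it with the original;
      -- the empty intersection is excluded.
      have h1 : le (atom (F (insert i S))) (oplus (atom {i}) (atom S)) := by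
        rw [← hF, ← h i, ← ih, ← map_oplus_of_mem_autLe hφ, ← mem_autLe.1 hφ]
        exact atom_union_le {i} S
      have hne : insert i S ≠ ∅ := Finset.insert_ne_empty i S
      have hne0 : F (insert i S) ≠ ∅ := by
        rw [← hF0]; exact F.injective.ne hne
      rcases eq_of_atom_le_oplus h1 hne0
        (by rw [← hF1]; exact F.injective.ne hu) with h2 | h2 | h2 | h2
      · have h3 : atom (insert i S) = atom {i} := φ.injective (by rw [hF, h2, h])
        rw [h3, h]
      · have h3 : atom (insert i S) = atom S := φ.injective (by rw [hF, h2, ih])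
        rw [h3, ih]
      · rw [Finset.singleton_inter_of_notMem hi] at h2
        exact absurd h2 hne0
      · rw [hF, h2, Finset.insert_eq]
  refine eq_one_of_map_diff hφ fun u hu => ?_
  have hu' : diff u = atom (Finset.univ.filter fun i => u i = 1) := by
    rw [atom]
    congr 1
    funext i
    have := hu i
    simp only [Finset.mem_filter, Finset.mem_univ, true_and]
    split_ifs <;> omega
  rw [hu', hatom]

/-! ### The action of `S_n × C_2` and the order automorphisms -/

theorem smul_apply (g : Equiv.Perm (Fin n) × Multiplicative (ZMod 2)) (A : ExpMat n)
    (i j : Fin n) : (g • A).1 i j =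
      if g.2 = 1 then A.1 (g.1⁻¹ i) (g.1⁻¹ j) else A.1 (g.1⁻¹ j) (g.1⁻¹ i) := by
  change (permute g.1 (if g.2 = 1 then A else transpose A)).1 i j = _
  split_ifs <;> rfl

theorem smul_atom_singleton (σ : Equiv.Perm (Fin n)) (i : Fin n) :
    (σ, (1 : Multiplicative (ZMod 2))) • (atom {i} : ExpMat n) = atom {σ i} := by
  refine entry_ext fun k l => ?_
  rw [smul_apply, if_pos rfl, atom_apply, atom_apply]
  simp only [Finset.mem_singleton, Equiv.Perm.inv_eq_iff_eq]

theorem smul_atom_of_ne_one {c : Multiplicative (ZMod 2)} (hc : c ≠ 1) (S : Finset (Fin n)) :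
    ((1 : Equiv.Perm (Fin n)), c) • (atom S : ExpMat n) = atom Sᶜ := by
  refine entry_ext fun k l => ?_
  rw [smul_apply, if_neg hc, atom_apply, atom_apply]
  simp [and_comm]

theorem atom_singleton_injective (hn : 3 ≤ n) {i j : Fin n}
    (h : (atom {i} : ExpMat n) = atom {j}) : i = j :=
  Finset.singleton_injective
    (atom_injective_of_ne (Finset.singleton_ne_empty i) (singleton_ne_univ hn i) h)

theorem toPerm_mem_autMaxPlus (g : Equiv.Perm (Fin n) × Multiplicative (ZMod 2)) :
    MulAction.toPerm g ∈ autMaxPlus n := by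
  refine ⟨⟨fun A B => ?_, fun A B => ?_⟩, ?_⟩
  · refine entry_ext fun i j => ?_
    simp only [MulAction.toPerm_apply, smul_apply, odot_apply]
    split_ifs <;> rfl
  · refine entry_ext fun i j => ?_
    simp only [MulAction.toPerm_apply, smul_apply, oplus_apply]
    split_ifs <;> rfl
  · refine entry_ext fun i j => ?_
    change (g • zero n).1 i j = _
    simp only [smul_apply, zero_apply, ite_self]

theorem autOplus_le_autLe : autOplus n ≤ autLe n := by
  intro φ hφ A B
  have h := hφ A B
  rw [le, le, ← h, φ.injective.eq_iff]

theorem autLe_le_autOplus : autLe n ≤ autOplus n := fun _ hφ => map_oplus_of_mem_autLe hφ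

theorem toPerm_mem_autLe (g : Equiv.Perm (Fin n) × Multiplicative (ZMod 2)) :
    MulAction.toPerm g ∈ autLe n :=
  autOplus_le_autLe (toPerm_mem_autMaxPlus g).1.2

theorem exists_toPerm_eq_of_map_singleton {φ : Equiv.Perm (ExpMat n)} (hn : 3 ≤ n)
    (hφ : φ ∈ autLe n) (h : ∀ i, ∃ a, φ (atom {i}) = atom {a}) :
    ∃ g : Equiv.Perm (Fin n) × Multiplicative (ZMod 2), MulAction.toPerm g = φ := by
  choose s hs using h
  have hinj : Function.Injective s := by
    intro i j hij
    refine atom_singleton_injective hn (φ.injective ?_)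
    rw [hs, hs, hij]
  let σ : Equiv.Perm (Fin n) := Equiv.ofBijective s (Finite.injective_iff_bijective.1 hinj)
  refine ⟨(σ, 1), ?_⟩
  have h1 : (MulAction.toPerm (σ, (1 : Multiplicative (ZMod 2))))⁻¹ * φ = 1 := by
    refine eq_one_of_map_singleton (mul_mem (inv_mem (toPerm_mem_autLe _)) hφ) fun i => ?_
    rw [Equiv.Perm.mul_apply, Equiv.Perm.inv_eq_iff_eq, MulAction.toPerm_apply,
      smul_atom_singleton, hs]
    rfl
  exact inv_mul_eq_one.1 h1

theorem exists_toPerm_eq {φ : Equiv.Perm (ExpMat n)} (hn : 3 ≤ n) (hφ : φ ∈ autLe n) :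
    ∃ g : Equiv.Perm (Fin n) × Multiplicative (ZMod 2), MulAction.toPerm g = φ := by
  rcases forall_map_singleton hn hφ with h | h
  · exact exists_toPerm_eq_of_map_singleton hn hφ h
  -- Transposition complements cuts, so composing with it returns to the case of singletons.
  · obtain ⟨c, hc⟩ := exists_ne (1 : Multiplicative (ZMod 2))
    obtain ⟨g, hg⟩ := exists_toPerm_eq_of_map_singleton hn
      (φ := MulAction.toPerm ((1 : Equiv.Perm (Fin n)), c) * φ)
      (mul_mem (toPerm_mem_autLe _) hφ) (fun i => by
        obtain ⟨a, ha⟩ := h i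
        refine ⟨a, ?_⟩
        rw [Equiv.Perm.mul_apply, ha, MulAction.toPerm_apply, smul_atom_of_ne_one hc, compl_compl])
    refine ⟨(1, c)⁻¹ * g, ?_⟩
    rw [← MulAction.toPermHom_apply, map_mul, map_inv, MulAction.toPermHom_apply,
      MulAction.toPermHom_apply, hg, inv_mul_cancel_left]

theorem range_toPermHom (hn : 3 ≤ n) :
    (MulAction.toPermHom (Equiv.Perm (Fin n) × Multiplicative (ZMod 2)) (ExpMat n)).range =
      autLe n := by
  ext φ
  constructor
  · rintro ⟨g, rfl⟩
    exact toPerm_mem_autLe g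
  · intro hφ
    obtain ⟨g, hg⟩ := exists_toPerm_eq hn hφ
    exact ⟨g, hg⟩

theorem autLe_le_autMaxPlus (hn : 3 ≤ n) : autLe n ≤ autMaxPlus n := by
  intro φ hφ
  obtain ⟨g, rfl⟩ := exists_toPerm_eq hn hφ
  exact toPerm_mem_autMaxPlus g

theorem faithfulSMul (hn : 3 ≤ n) :
    FaithfulSMul (Equiv.Perm (Fin n) × Multiplicative (ZMod 2)) (ExpMat n) := by
  have key : ∀ g : Equiv.Perm (Fin n) × Multiplicative (ZMod 2),
      (∀ A : ExpMat n, g • A = A) → g = 1 := by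
    rintro ⟨σ, c⟩ h
    have hc : c = 1 := by
      by_contra hc
      let i : Fin n := ⟨0, by omega⟩
      -- A transposing element sends this cut to that of a singleton, while the complement of a
      -- singleton has `n - 1 ≥ 2` elements.
      have h1 := h (atom {i}ᶜ)
      have h2 : (σ, c) = (σ, (1 : Multiplicative (ZMod 2))) * (1, c) := by simp
      rw [h2, mul_smul, smul_atom_of_ne_one hc, compl_compl, smul_atom_singleton] at h1
      have h3 := congrArg Finset.card (atom_injective_of_ne (Finset.singleton_ne_empty _)
        (singleton_ne_univ hn _) h1)
      rw [Finset.card_compl, Finset.card_singleton, Finset.card_singleton, Fintype.card_fin] at h3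
      omega
    subst hc
    refine Prod.ext (Equiv.ext fun i => ?_) rfl
    have h1 := h (atom {i})
    rw [smul_atom_singleton] at h1
    exact atom_singleton_injective hn h1
  refine ⟨fun {g₁ g₂} h => ?_⟩
  have : g₂⁻¹ * g₁ = 1 := key _ fun A => by rw [mul_smul, h, inv_smul_smul]
  exact (inv_mul_eq_one.1 this).symm

/-! ### Facet functionals of the cone and additive automorphisms -/

/-- The entry at `(i, j)` as an integer-valued functional. -/
def coord (i j : Fin n) (A : ExpMat n) : ℤ := A.1 i j

/-- The defect in the triangle inequality for `(i, j, k)`. -/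
def tri (i j k : Fin n) (A : ExpMat n) : ℤ := A.1 i j + A.1 j k - A.1 i k

/-- The functionals that define the facets of the cone of exponent matrices. -/
def IsFacet (g : ExpMat n → ℤ) : Prop :=
  (∃ i j, i ≠ j ∧ g = coord i j) ∨ ∃ i j k, i ≠ j ∧ j ≠ k ∧ i ≠ k ∧ g = tri i j k

theorem isFacet_coord {i j : Fin n} (h : i ≠ j) : IsFacet (coord i j) := Or.inl ⟨i, j, h, rfl⟩

theorem isFacet_tri {i j k : Fin n} (hij : i ≠ j) (hjk : j ≠ k) (hik : i ≠ k) :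
    IsFacet (tri i j k) := Or.inr ⟨i, j, k, hij, hjk, hik, rfl⟩

namespace IsFacet

variable {g : ExpMat n → ℤ}

theorem nonneg (hg : IsFacet g) (A : ExpMat n) : 0 ≤ g A := by
  rcases hg with ⟨i, j, -, rfl⟩ | ⟨i, j, k, -, -, -, rfl⟩
  · exact Int.natCast_nonneg _
  · have := A.triangle i j k
    rw [tri]
    omega

theorem map_odot (hg : IsFacet g) (A B : ExpMat n) : g (odot A B) = g A + g B := by
  rcases hg with ⟨i, j, -, rfl⟩ | ⟨i, j, k, -, -, -, rfl⟩
  · simp only [coord, odot_apply]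
    push_cast
    ring
  · simp only [tri, odot_apply]
    push_cast
    ring

theorem exists_bound (A : ExpMat n) : ∃ M : ℕ, ∀ g : ExpMat n → ℤ, IsFacet g → g A ≤ M := by
  obtain ⟨M, hM⟩ := exists_entry_bound A
  refine ⟨2 * M, ?_⟩
  rintro g (⟨i, j, -, rfl⟩ | ⟨i, j, k, -, -, -, rfl⟩)
  · have := hM i j
    rw [coord]
    omega
  · have := hM i j
    have := hM j k
    rw [tri]
    omega

end IsFacet

/-- The matrix with all off-diagonal entries one. -/
def unit (n : ℕ) : ExpMat n :=
  ⟨Matrix.of fun i j => if i = j then 0 else 1, by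
    refine ⟨fun i => by simp, fun i j k hij hjk hik => ?_⟩
    simp [hij, hjk, hik]⟩

theorem IsFacet.map_unit {g : ExpMat n → ℤ} (hg : IsFacet g) : g (unit n) = 1 := by
  rcases hg with ⟨i, j, hij, rfl⟩ | ⟨i, j, k, hij, hjk, hik, rfl⟩
  · simp [coord, unit, hij]
  · simp [tri, unit, hij, hjk, hik]

/-- The facet inequalities for `B - A` are exactly the conditions that it be an exponent matrix.
Divisibility in the monoid is therefore read off from the facets. -/
theorem exists_odot_eq {A B : ExpMat n} (h : ∀ g : ExpMat n → ℤ, IsFacet g → g A ≤ g B) :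
    ∃ C, odot A C = B := by
  have hc : ∀ i j, A.1 i j ≤ B.1 i j := by
    intro i j
    by_cases hij : i = j
    · subst hij; rw [A.2.1 i]; exact Nat.zero_le _
    · exact Int.ofNat_le.1 (h _ (isFacet_coord hij))
  refine ⟨⟨Matrix.of fun i j => B.1 i j - A.1 i j, fun i => ?_, fun i j k hij hjk hik => ?_⟩,
    entry_ext fun i j => ?_⟩
  · simp [A.2.1 i, B.2.1 i]
  · have h1 := h _ (isFacet_tri hij hjk hik)
    have := hc i j
    have := hc j k
    have := hc i k
    simp only [tri] at h1
    simp only [Matrix.of_apply]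
    omega
  · exact Nat.add_sub_cancel' (hc i j)

/-- The `m`-fold sum of `A`. -/
def mult (m : ℕ) (A : ExpMat n) : ExpMat n :=
  Nat.rec (zero n) (fun _ B => odot B A) m

theorem map_mult {y : ExpMat n → ℤ} (hy : ∀ A B, y (odot A B) = y A + y B) (m : ℕ)
    (A : ExpMat n) : y (mult m A) = m * y A := by
  induction m with
  | zero =>
    have h : y (zero n) = y (zero n) + y (zero n) := hy (zero n) (zero n)
    change y (zero n) = _
    push_cast
    linarith
  | succ m ih =>
    change y (odot (mult m A) A) = _
    rw [hy, ih]
    push_cast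
    ring

theorem exists_coord_facet_witness {i j : Fin n} (hij : i ≠ j) :
    ∃ Z : ExpMat n, coord i j Z = 0 ∧
      (∀ p q, p ≠ q → (p, q) ≠ (i, j) → 0 < coord p q Z) ∧
      ∀ p q r, p ≠ q → q ≠ r → p ≠ r → 0 < tri p q r Z := by
  -- Sums avoiding the entry `(i, j)` are at least `4`, above the maximum `3`. A sum using it is `0
  -- + 3`, against an entry in row `i` or column `j`, which is `2`.
  let z : Fin n → Fin n → ℕ := fun k l =>
    if k = l then 0 else if k = i ∧ l = j then 0 else if k = i ∨ l = j then 2 else 3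
  have hz : ∀ p q r, p ≠ q → q ≠ r → p ≠ r → z p r < z p q + z q r := by
    intro p q r hpq hqr hpr
    simp only [z]
    grind
  refine ⟨⟨Matrix.of z, fun i => by simp [z], fun p q r h1 h2 h3 => (hz p q r h1 h2 h3).le⟩,
    ?_, ?_, ?_⟩
  · simp [coord, z]
  · intro p q hpq hne
    have : 0 < z p q := by
      simp only [z]
      grind
    exact Int.natCast_pos.2 this
  · intro p q r h1 h2 h3
    have := hz p q r h1 h2 h3
    simp only [tri, Matrix.of_apply]
    omega

theorem exists_tri_facet_witness {i j k : Fin n} (hij : i ≠ j) (hjk : j ≠ k) (hik : i ≠ k) :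
    ∃ Z : ExpMat n, tri i j k Z = 0 ∧ (∀ p q, p ≠ q → 0 < coord p q Z) ∧
      ∀ p q r, p ≠ q → q ≠ r → p ≠ r → (p, q, r) ≠ (i, j, k) → 0 < tri p q r Z := by
  -- Two entries `2` meet only along `i, j, k`, where `2 + 2 = 4`; every other sum is at least `5`,
  -- above the maximum `4`.
  let z : Fin n → Fin n → ℕ := fun p q =>
    if p = q then 0 else if p = i ∧ q = k then 4
    else if (p = i ∧ q = j) ∨ (p = j ∧ q = k) then 2 else 3
  have hz0 : z i k = z i j + z j k := by
    simp only [z]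
    grind
  have hz : ∀ p q r, p ≠ q → q ≠ r → p ≠ r → (p, q, r) ≠ (i, j, k) → z p r < z p q + z q r := by
    intro p q r hpq hqr hpr hne
    simp only [z]
    grind
  refine ⟨⟨Matrix.of z, fun i => by simp [z], fun p q r h1 h2 h3 => ?_⟩, ?_, ?_, ?_⟩
  · by_cases h : (p, q, r) = (i, j, k)
    · simp only [Prod.mk.injEq] at h
      obtain ⟨rfl, rfl, rfl⟩ := h
      exact hz0.le
    · exact (hz p q r h1 h2 h3 h).le
  · simp only [tri, Matrix.of_apply]
    omega
  · intro p q hpq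
    have : 0 < z p q := by
      simp only [z]
      grind
    exact Int.natCast_pos.2 this
  · intro p q r h1 h2 h3 h4
    have := hz p q r h1 h2 h3 h4
    simp only [tri, Matrix.of_apply]
    omega

/-- Every facet has a point in its relative interior. -/
theorem IsFacet.exists_witness {g : ExpMat n → ℤ} (hg : IsFacet g) :
    ∃ Z, g Z = 0 ∧ ∀ h : ExpMat n → ℤ, IsFacet h → h ≠ g → 0 < h Z := by
  rcases hg with ⟨i, j, hij, rfl⟩ | ⟨i, j, k, hij, hjk, hik, rfl⟩
  · obtain ⟨Z, h0, h1, h2⟩ := exists_coord_facet_witness hij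
    refine ⟨Z, h0, ?_⟩
    rintro h (⟨p, q, hpq, rfl⟩ | ⟨p, q, r, hpq, hqr, hpr, rfl⟩) hne
    · refine h1 p q hpq fun e => hne ?_
      simp only [Prod.mk.injEq] at e
      rw [e.1, e.2]
    · exact h2 p q r hpq hqr hpr
  · obtain ⟨Z, h0, h1, h2⟩ := exists_tri_facet_witness hij hjk hik
    refine ⟨Z, h0, ?_⟩
    rintro h (⟨p, q, hpq, rfl⟩ | ⟨p, q, r, hpq, hqr, hpr, rfl⟩) hne
    · exact h1 p q hpq
    · refine h2 p q r hpq hqr hpr fun e => hne ?_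
      simp only [Prod.mk.injEq] at e
      rw [e.1, e.2.1, e.2.2]

theorem mem_autOdot {φ : Equiv.Perm (ExpMat n)} :
    φ ∈ autOdot n ↔ ∀ A B, φ (odot A B) = odot (φ A) (φ B) := Iff.rfl

/-- A nonnegative additive functional that vanishes in the relative interior of a facet is a
multiple of the functional of that facet. -/
theorem IsFacet.eq_mul_of_witness {g y : ExpMat n → ℤ} (hg : IsFacet g)
    (hy : ∀ A B, y (odot A B) = y A + y B) (hy0 : ∀ A, 0 ≤ y A) {Z : ExpMat n} (hZ : g Z = 0)
    (hZ' : ∀ h : ExpMat n → ℤ, IsFacet h → h ≠ g → 0 < h Z) (hyZ : y Z = 0) (B : ExpMat n) :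
    y B = g B * y (unit n) := by
  obtain ⟨m, hm⟩ := Int.eq_ofNat_of_zero_le (hg.nonneg B)
  -- With `m = g B`, the difference `V = m Z + B - m unit` lies in the cone, on the facet `g = 0`. A
  -- multiple of `Z` dominates it, so `y V = 0`, and evaluating `y` gives the claim.
  obtain ⟨V, hV⟩ := exists_odot_eq (A := mult m (unit n)) (B := odot (mult m Z) B) fun h hh => by
    rw [hh.map_odot, map_mult hh.map_odot, map_mult hh.map_odot, hh.map_unit]
    by_cases e : h = g
    · rw [e, hZ, hm]; simp
    · have h1 := hZ' h hh e
      have h2 := hh.nonneg B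
      nlinarith [Int.natCast_nonneg m]
  have hgV : g V = 0 := by
    have := congrArg g hV
    rw [hg.map_odot, hg.map_odot, map_mult hg.map_odot, map_mult hg.map_odot, hg.map_unit, hZ,
      hm] at this
    linarith
  obtain ⟨M, hM⟩ := IsFacet.exists_bound V
  obtain ⟨C, hC⟩ := exists_odot_eq (A := V) (B := mult M Z) fun h hh => by
    rw [map_mult hh.map_odot]
    by_cases e : h = g
    · rw [e, hZ, hgV]; simp
    · have h1 := hZ' h hh e
      have h2 := hM h hh
      nlinarith [Int.natCast_nonneg M]
  have hyV : y V = 0 := by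
    have := congrArg y hC
    rw [hy, map_mult hy, hyZ, mul_zero] at this
    linarith [hy0 V, hy0 C]
  have := congrArg y hV
  rw [hy, hy, map_mult hy, map_mult hy, hyZ, hyV, ← hm] at this
  linarith

/-- A nonnegative additive functional that is positive somewhere is positive on each interior
point of the cone. -/
theorem pos_of_forall_facet_pos {y : ExpMat n → ℤ} (hy : ∀ A B, y (odot A B) = y A + y B)
    (hy0 : ∀ A, 0 ≤ y A) {W V : ExpMat n} (hW : ∀ h : ExpMat n → ℤ, IsFacet h → 0 < h W)
    (hV : 0 < y V) : 0 < y W := by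
  obtain ⟨M, hM⟩ := IsFacet.exists_bound V
  obtain ⟨C, hC⟩ := exists_odot_eq (A := V) (B := mult M W) fun h hh => by
    rw [map_mult hh.map_odot]
    have h1 := hW h hh
    have h2 := hM h hh
    nlinarith [Int.natCast_nonneg M]
  have := congrArg y hC
  rw [hy, map_mult hy] at this
  by_contra hlt
  have h0 : y W = 0 := le_antisymm (not_lt.1 hlt) (hy0 W)
  rw [h0, mul_zero] at this
  linarith [hy0 C]

/-- Let `Z` be interior to the facet of `g`. Its preimage lies on some facet `h = 0`, for otherwise
`g ∘ φ` would be positive there. Then `h ∘ φ⁻¹` vanishes at `Z`, hence is a multiple of `g`, and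
integrality together with `h unit = 1` makes the factor `1`. -/
theorem IsFacet.comp {φ : Equiv.Perm (ExpMat n)} (hφ : φ ∈ autOdot n) {g : ExpMat n → ℤ}
    (hg : IsFacet g) : IsFacet fun A => g (φ A) := by
  obtain ⟨Z, hZ, hZ'⟩ := hg.exists_witness
  obtain ⟨h, hh, hW⟩ : ∃ h : ExpMat n → ℤ, IsFacet h ∧ h (φ.symm Z) = 0 := by
    by_contra! hno
    have := pos_of_forall_facet_pos (y := fun A => g (φ A)) (W := φ.symm Z)
      (V := φ.symm (unit n)) (fun A B => by rw [mem_autOdot.1 hφ, hg.map_odot])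
      (fun A => hg.nonneg _) (fun h hh => lt_of_le_of_ne (hh.nonneg _) (hno h hh).symm)
      (by rw [φ.apply_symm_apply, hg.map_unit]; exact one_pos)
    rw [φ.apply_symm_apply, hZ] at this
    exact lt_irrefl 0 this
  have hy : ∀ A B, h (φ.symm (odot A B)) = h (φ.symm A) + h (φ.symm B) := fun A B => by
    rw [← hh.map_odot]
    congr 1
    rw [Equiv.symm_apply_eq, mem_autOdot.1 hφ, φ.apply_symm_apply, φ.apply_symm_apply]
  have key := hg.eq_mul_of_witness (y := fun A => h (φ.symm A)) hy (fun A => hh.nonneg _) hZ hZ' hW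
  have h1 := key (φ (unit n))
  rw [φ.symm_apply_apply, hh.map_unit] at h1
  have h2 : h (φ.symm (unit n)) = 1 :=
    Int.eq_one_of_mul_eq_one_left (hh.nonneg _) h1.symm
  have h3 : (fun A => g (φ A)) = h := by
    funext A
    have := key (φ A)
    rw [φ.symm_apply_apply, h2, mul_one] at this
    exact this.symm
  rw [h3]
  exact hh

theorem coord_injective {i j p q : Fin n} (hij : i ≠ j) (hpq : p ≠ q)
    (h : coord p q = coord i j) : (p, q) = (i, j) := by
  obtain ⟨Z, h0, h1, -⟩ := exists_coord_facet_witness hij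
  by_contra hne
  have := h1 p q hpq hne
  rw [h, h0] at this
  exact lt_irrefl 0 this

theorem tri_injective {i j k p q r : Fin n} (hij : i ≠ j) (hjk : j ≠ k) (hik : i ≠ k)
    (hpq : p ≠ q) (hqr : q ≠ r) (hpr : p ≠ r) (h : tri p q r = tri i j k) :
    (p, q, r) = (i, j, k) := by
  obtain ⟨Z, h0, -, h1⟩ := exists_tri_facet_witness hij hjk hik
  by_contra hne
  have := h1 p q r hpq hqr hpr hne
  rw [h, h0] at this
  exact lt_irrefl 0 this

theorem coord_ne_tri {i j p q r : Fin n} (hij : i ≠ j) (hpq : p ≠ q) (hqr : q ≠ r) (hpr : p ≠ r) :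
    coord i j ≠ tri p q r := by
  obtain ⟨Z, h0, -, h1⟩ := exists_coord_facet_witness hij
  intro h
  have := h1 p q r hpq hqr hpr
  rw [← h, h0] at this
  exact lt_irrefl 0 this

/-! ### Invariance of the weight and the matrices of least weight -/

/-- The sum of all entries. -/
def weight (A : ExpMat n) : ℕ := ∑ i, ∑ j, A.1 i j

/-- The triples of pairwise distinct indices. -/
def distinctTriples (n : ℕ) : Finset (Fin n × Fin n × Fin n) :=
  Finset.univ.filter fun t => t.1 ≠ t.2.1 ∧ t.2.1 ≠ t.2.2 ∧ t.1 ≠ t.2.2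

theorem natCast_weight (A : ExpMat n) : (weight A : ℤ) = ∑ i, ∑ j, coord i j A := by
  simp only [weight, coord, Nat.cast_sum]

theorem coord_self (i : Fin n) (A : ExpMat n) : coord i i A = 0 := by
  rw [coord, A.2.1, Nat.cast_zero]

theorem sum_offDiag_coord (A : ExpMat n) :
    ∑ p ∈ (Finset.univ : Finset (Fin n)).offDiag, coord p.1 p.2 A = weight A := by
  rw [natCast_weight, ← Finset.sum_product', Finset.univ_product_univ]
  refine Finset.sum_subset (Finset.subset_univ _) fun p _ hp => ?_
  have : p.1 = p.2 := by simpa using hp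
  rw [← this, coord_self]

theorem sum_distinctTriples_fst (hn : 3 ≤ n) (A : ExpMat n) :
    ∑ t ∈ distinctTriples n, coord t.1 t.2.1 A = (n - 2 : ℤ) * weight A := by
  rw [distinctTriples, Finset.sum_filter, ← Finset.univ_product_univ, Finset.sum_product,
    natCast_weight, Finset.mul_sum]
  refine Finset.sum_congr rfl fun i _ => ?_
  rw [← Finset.univ_product_univ, Finset.sum_product, Finset.mul_sum]
  refine Finset.sum_congr rfl fun j _ => ?_
  dsimp only
  rw [← Finset.sum_filter, Finset.sum_const, nsmul_eq_mul]
  by_cases hij : i = j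
  · subst hij
    rw [coord_self, mul_zero, mul_zero]
  · have h1 : (Finset.univ.filter fun k => i ≠ j ∧ j ≠ k ∧ i ≠ k) =
        (Finset.univ.erase i).erase j := by
      ext k
      simp [hij, eq_comm]
    rw [h1, Finset.card_erase_of_mem (by simp [Ne.symm hij]), Finset.card_erase_of_mem (by simp),
      Finset.card_univ, Fintype.card_fin]
    congr 1
    omega

/-- Swapping the first two indices cancels the second summand of the defect against the third; in
the first, each pair extends to `n - 2` triples. -/
theorem sum_distinctTriples_tri (hn : 3 ≤ n) (A : ExpMat n) :
    ∑ t ∈ distinctTriples n, tri t.1 t.2.1 t.2.2 A = (n - 2 : ℤ) * weight A := by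
  have h : ∑ t ∈ distinctTriples n, coord t.2.1 t.2.2 A =
      ∑ t ∈ distinctTriples n, coord t.1 t.2.2 A := by
    refine Finset.sum_nbij' (fun t => (t.2.1, t.1, t.2.2)) (fun t => (t.2.1, t.1, t.2.2))
      ?_ ?_ ?_ ?_ ?_
    · simp +contextual [distinctTriples, eq_comm]
    · simp +contextual [distinctTriples, eq_comm]
    · simp
    · simp
    · simp
  have h' : ∀ t : Fin n × Fin n × Fin n, tri t.1 t.2.1 t.2.2 A =
      coord t.1 t.2.1 A + coord t.2.1 t.2.2 A - coord t.1 t.2.2 A := fun _ => rfl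
  simp only [h']
  rw [Finset.sum_sub_distrib, Finset.sum_add_distrib, h, sum_distinctTriples_fst hn]
  ring

open scoped Classical in
/-- The set of all facet functionals. -/
noncomputable def facets (n : ℕ) : Finset (ExpMat n → ℤ) :=
  (Finset.univ : Finset (Fin n)).offDiag.image (fun p => coord p.1 p.2) ∪
    (distinctTriples n).image fun t => tri t.1 t.2.1 t.2.2

theorem mem_facets {g : ExpMat n → ℤ} : g ∈ facets n ↔ IsFacet g := by
  simp only [facets, distinctTriples, Finset.mem_union, Finset.mem_image, Finset.mem_offDiag,
    Finset.mem_filter, Finset.mem_univ, true_and, Prod.exists, IsFacet, and_assoc,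
    @eq_comm _ g]

theorem sum_facets (hn : 3 ≤ n) (A : ExpMat n) :
    ∑ g ∈ facets n, g A = (n - 1 : ℤ) * weight A := by
  classical
  rw [facets, Finset.sum_union, Finset.sum_image, Finset.sum_image, sum_offDiag_coord,
    sum_distinctTriples_tri hn]
  · ring
  · intro s hs t ht h
    simp only [distinctTriples, Finset.coe_filter, Finset.mem_univ, true_and,
      Set.mem_ofPred_eq] at hs ht
    exact tri_injective ht.1 ht.2.1 ht.2.2 hs.1 hs.2.1 hs.2.2 h
  · intro s hs t ht h
    simp only [Finset.coe_offDiag, Set.mem_offDiag] at hs ht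
    exact coord_injective ht.2.2 hs.2.2 h
  · rw [Finset.disjoint_left]
    intro g hg hg'
    obtain ⟨s, hs, rfl⟩ := Finset.mem_image.1 hg
    obtain ⟨t, ht, h⟩ := Finset.mem_image.1 hg'
    simp only [distinctTriples, Finset.mem_filter, Finset.mem_univ, true_and] at ht
    rw [Finset.mem_offDiag] at hs
    exact coord_ne_tri hs.2.2 ht.1 ht.2.1 ht.2.2 h.symm

theorem weight_map {φ : Equiv.Perm (ExpMat n)} (hn : 3 ≤ n) (hφ : φ ∈ autOdot n) (A : ExpMat n) :
    weight (φ A) = weight A := by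
  have h : ∑ g ∈ facets n, g (φ A) = ∑ g ∈ facets n, g A := by
    refine Finset.sum_nbij' (fun g B => g (φ B)) (fun g B => g (φ.symm B)) ?_ ?_ ?_ ?_ ?_
    · intro g hg
      exact mem_facets.2 ((mem_facets.1 hg).comp hφ)
    · intro g hg
      exact mem_facets.2 ((mem_facets.1 hg).comp (inv_mem hφ))
    · intro g _
      simp
    · intro g _
      simp
    · intro g _
      rfl
  rw [sum_facets hn, sum_facets hn] at h
  have hne : (n - 1 : ℤ) ≠ 0 := by omega
  exact_mod_cast mul_left_cancel₀ hne h

theorem weight_atom_singleton (j : Fin n) : weight (atom {j}) = n - 1 := by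
  simp only [weight, atom_apply]
  rw [Finset.sum_comm, Finset.sum_eq_single j]
  · simp only [Finset.mem_singleton, true_and]
    rw [← Finset.sum_filter, Finset.sum_const, Finset.filter_ne', Finset.card_erase_of_mem
      (Finset.mem_univ j), Finset.card_univ, Fintype.card_fin, smul_eq_mul, mul_one]
  · intro l _ hl
    simp [hl]
  · simp

theorem weight_atom_singleton_compl (i : Fin n) : weight (atom {i}ᶜ) = n - 1 := by
  rw [weight, Finset.sum_eq_single i]
  · simp only [atom_apply, Finset.mem_compl, Finset.mem_singleton, not_true, not_false_eq_true,
      and_true]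
    rw [← Finset.sum_filter, Finset.sum_const, Finset.filter_ne', Finset.card_erase_of_mem
      (Finset.mem_univ i), Finset.card_univ, Fintype.card_fin, smul_eq_mul, mul_one]
  · intro l _ hl
    simp [atom_apply, hl]
  · simp

/-- The array is split into row `p`, the remainder of column `q`, and the rest, with the first two
paired along the paths `p, k, q`. -/
theorem sum_sum_eq_of_apply_self {a : Fin n → Fin n → ℕ} {p : Fin n} (h : a p p = 0)
    (q : Fin n) : ∑ i, ∑ j, a i j = ∑ k ∈ Finset.univ.erase p, (a p k + a k q) +
      ∑ i ∈ Finset.univ.erase p, ∑ j ∈ Finset.univ.erase q, a i j := by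
  rw [← Finset.add_sum_erase _ _ (Finset.mem_univ p),
    ← Finset.add_sum_erase _ (a p) (Finset.mem_univ p), h, zero_add, Finset.sum_add_distrib,
    add_assoc, ← Finset.sum_add_distrib (f := fun k => a k q)]
  simp only [Finset.add_sum_erase _ _ (Finset.mem_univ q)]

theorem weight_eq (A : ExpMat n) (p q : Fin n) :
    weight A = ∑ k ∈ Finset.univ.erase p, (A.1 p k + A.1 k q) +
      ∑ i ∈ Finset.univ.erase p, ∑ j ∈ Finset.univ.erase q, A.1 i j :=
  sum_sum_eq_of_apply_self (A.2.1 p) q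

/-- The nonzero matrices of minimal weight have their support in one row or one column. -/
theorem eq_atom_of_weight_le {A : ExpMat n} (h : weight A ≤ n - 1) :
    A = zero n ∨ ∃ i, A = atom {i} ∨ A = atom {i}ᶜ := by
  by_cases h0 : ∃ p q, 0 < A.1 p q
  swap
  · push Not at h0
    exact Or.inl (entry_ext fun i j => Nat.le_zero.1 (h0 i j))
  obtain ⟨p, q, hpq⟩ := h0
  have hne : p ≠ q := by
    rintro rfl
    rw [A.2.1] at hpq
    exact lt_irrefl 0 hpq
  have hone : ∀ k ∈ Finset.univ.erase p, 1 ≤ A.1 p k + A.1 k q := fun k _ => by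
    have := A.triangle p k q
    omega
  have hsum : ∑ _k ∈ (Finset.univ : Finset (Fin n)).erase p, (1 : ℕ) = n - 1 := by
    rw [Finset.sum_const, Finset.card_erase_of_mem (Finset.mem_univ p), Finset.card_univ,
      Fintype.card_fin, smul_eq_mul, mul_one]
  -- Each of the `n - 1` paths `p, k, q` has length at least one. The weight bound therefore makes
  -- every path have length exactly one and everything off row `p` and column `q` vanish.
  have hle := Finset.sum_le_sum hone
  have hw := weight_eq A p q
  have hrest : ∑ i ∈ Finset.univ.erase p, ∑ j ∈ Finset.univ.erase q, A.1 i j = 0 := by omega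
  have heq : ∑ _k ∈ Finset.univ.erase p, 1 = ∑ k ∈ Finset.univ.erase p, (A.1 p k + A.1 k q) := by
    omega
  have hrest' : ∀ i j, i ≠ p → j ≠ q → A.1 i j = 0 := by
    intro i j hi hj
    have h1 := Finset.sum_eq_zero_iff.1 hrest i (by simp [hi])
    exact Finset.sum_eq_zero_iff.1 h1 j (by simp [hj])
  have heq' : ∀ k, k ≠ p → 1 = A.1 p k + A.1 k q := fun k hk =>
    (Finset.sum_eq_sum_iff_of_le hone).1 heq k (by simp [hk])
  have hqq := A.2.1 q
  have hpp := A.2.1 p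
  have hpq1 : A.1 p q = 1 := by
    have := heq' q hne.symm
    omega
  right
  by_cases hall : ∀ k, k ≠ p → A.1 p k = 1
  · refine ⟨p, Or.inr (entry_ext fun k l => ?_)⟩
    simp only [atom_apply, Finset.mem_compl, Finset.mem_singleton, not_not]
    by_cases hk : k = p
    · subst hk
      by_cases hl : l = k
      · subst hl; simp [hpp]
      · simp [hl, hall l hl]
    · simp only [hk, and_false, if_false]
      by_cases hl : l = q
      · subst hl
        have h1 := heq' k hk
        have h2 := hall k hk
        omega
      · exact hrest' k l hk hl
  · push Not at hall
    obtain ⟨k, hkp, hk⟩ := hall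
    have hk0 : A.1 p k = 0 := by
      have := heq' k hkp
      omega
    -- A single zero in row `p` spreads along the row through row `k`, leaving only column `q`.
    have hzero : ∀ l, l ≠ q → A.1 p l = 0 := by
      intro l hl
      have h1 := A.triangle p k l
      have h2 := hrest' k l hkp hl
      omega
    refine ⟨q, Or.inl (entry_ext fun i l => ?_)⟩
    simp only [atom_apply, Finset.mem_singleton]
    by_cases hl : l = q
    · subst hl
      by_cases hi : i = l
      · subst hi; simp [hqq]
      · simp only [hi, not_false_eq_true, and_self, if_true]
        by_cases hip : i = p
        · rw [hip, hpq1]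
        · have h1 := heq' i hip
          have h2 := hzero i hi
          omega
    · simp only [hl, false_and, if_false]
      by_cases hip : i = p
      · rw [hip]; exact hzero l hl
      · exact hrest' i l hip hl

/-! ### Additive automorphisms permute entries -/

/-- On a cut the defect is `1` when `q` lies on the side opposite to both `p` and `r`, and `0`
otherwise, which is symmetric in `p` and `r`. -/
theorem tri_atom (S : Finset (Fin n)) (p q r : Fin n) : tri p q r (atom S) = tri r q p (atom S) := by
  simp only [tri, atom_apply]
  by_cases hp : p ∈ S <;> by_cases hq : q ∈ S <;> by_cases hr : r ∈ S <;> simp [hp, hq, hr]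

theorem tri_swap_of_weight_le {A : ExpMat n} (h : weight A ≤ n - 1) (p q r : Fin n) :
    tri p q r A = tri r q p A := by
  rcases eq_atom_of_weight_le h with rfl | ⟨i, rfl | rfl⟩
  · simp [tri, zero_apply]
  · exact tri_atom _ p q r
  · exact tri_atom _ p q r

theorem coord_atom_singleton {i j : Fin n} (hij : i ≠ j) : coord i j (atom {j}) = 1 := by
  simp [coord, atom_apply, hij]

theorem coord_atom_singleton_compl {i j : Fin n} (hij : i ≠ j) : coord i j (atom {i}ᶜ) = 1 := by
  simp [coord, atom_apply, hij.symm]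

/-- A triangle defect equal to `1` on both cuts would need its middle index to be both `j` and `i`.
-/
theorem IsFacet.eq_coord {g : ExpMat n → ℤ} (hg : IsFacet g) {i j : Fin n} (hij : i ≠ j)
    (h1 : g (atom {j}) = 1) (h2 : g (atom {i}ᶜ) = 1) : g = coord i j := by
  rcases hg with ⟨p, q, hpq, rfl⟩ | ⟨p, q, r, hpq, hqr, hpr, rfl⟩
  · simp only [coord, atom_apply, Finset.mem_singleton, Finset.mem_compl] at h1 h2
    have e1 : q = j := by
      by_contra e
      simp [e] at h1
    have e2 : p = i := by
      by_contra e
      simp [e] at h2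
    rw [e1, e2]
  · exfalso
    simp only [tri, atom_apply, Finset.mem_singleton, Finset.mem_compl] at h1 h2
    have e1 : q = j := by
      by_contra e
      by_cases hr : r = j
      · subst hr; simp [hqr, hpr] at h1
      · simp [e, hr] at h1
    have e2 : q = i := by
      by_contra e
      by_cases hp : p = i
      · subst hp; simp [hpr.symm, e] at h2
      · simp [e, hp] at h2
    exact hij (e2.symm.trans e1)

/-- An additive automorphism permutes the entries. -/
theorem exists_coord_map {φ : Equiv.Perm (ExpMat n)} (hn : 3 ≤ n) (hφ : φ ∈ autOdot n)
    {i j : Fin n} (hij : i ≠ j) : ∃ p q, ∀ A, (φ A).1 i j = A.1 p q := by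
  rcases (isFacet_coord hij).comp hφ with ⟨p, q, -, h⟩ | ⟨p, q, r, hpq, hqr, hpr, h⟩
  · exact ⟨p, q, fun A => Int.ofNat_inj.1 (congrFun h A)⟩
  · exfalso
    -- If the entry became the defect of `p, q, r`, the reversed defect, pulled back by `φ⁻¹`, would
    -- agree with the entry at least weight. By `IsFacet.eq_coord` that pullback is then the entry
    -- itself, so the two defects coincide and `p = r`.
    have hval : ∀ A, weight A = n - 1 → tri r q p (φ.symm A) = coord i j A := by
      intro A hA
      have hA' : weight (φ.symm A) = n - 1 := (weight_map hn (inv_mem hφ) A).trans hA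
      rw [← tri_swap_of_weight_le hA'.le, ← congrFun h, φ.apply_symm_apply]
    have h1 := ((isFacet_tri hqr.symm hpq.symm hpr.symm).comp (inv_mem hφ)).eq_coord hij
      ((hval _ (weight_atom_singleton j)).trans (coord_atom_singleton hij))
      ((hval _ (weight_atom_singleton_compl i)).trans (coord_atom_singleton_compl hij))
    have h2 : tri r q p = tri p q r := by
      rw [← h, ← h1]
      funext A
      exact congrArg (tri r q p) (φ.symm_apply_apply A).symm
    have h3 := tri_injective hpq hqr hpr hqr.symm hpq.symm hpr.symm h2
    exact hpr (congrArg Prod.fst h3).symm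

theorem le_map_of_mem_autOdot {φ : Equiv.Perm (ExpMat n)} (hn : 3 ≤ n) (hφ : φ ∈ autOdot n)
    {A B : ExpMat n} (h : le A B) : le (φ A) (φ B) := by
  refine le_iff.2 fun i j => ?_
  by_cases hij : i = j
  · subst hij
    rw [(φ A).2.1, (φ B).2.1]
  · obtain ⟨p, q, hpq⟩ := exists_coord_map hn hφ hij
    rw [hpq, hpq]
    exact le_iff.1 h p q

theorem autOdot_le_autLe (hn : 3 ≤ n) : autOdot n ≤ autLe n := by
  intro φ hφ A B
  refine ⟨le_map_of_mem_autOdot hn hφ, fun h => ?_⟩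
  have := le_map_of_mem_autOdot hn (inv_mem hφ) h
  simpa using this

end ExpMat

theorem corollary4p6 (n : ℕ) (hn : 3 ≤ n) :
    ExpMat.autOdot n = ExpMat.autOplus n ∧
    ExpMat.autOplus n = ExpMat.autLe n ∧
    ExpMat.autLe n = ExpMat.autMaxPlus n ∧
    FaithfulSMul (Equiv.Perm (Fin n) × Multiplicative (ZMod 2)) (ExpMat n) ∧
    (MulAction.toPermHom (Equiv.Perm (Fin n) × Multiplicative (ZMod 2)) (ExpMat n)).range =
      ExpMat.autMaxPlus n ∧
    Nonempty (ExpMat.autOdot n ≃* Equiv.Perm (Fin n) × Multiplicative (ZMod 2)) ∧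
    Nonempty (ExpMat.autOplus n ≃* Equiv.Perm (Fin n) × Multiplicative (ZMod 2)) ∧
    Nonempty (ExpMat.autLe n ≃* Equiv.Perm (Fin n) × Multiplicative (ZMod 2)) ∧
    Nonempty (ExpMat.autMaxPlus n ≃* Equiv.Perm (Fin n) × Multiplicative (ZMod 2)) := by
  have hmax : ExpMat.autLe n ≤ ExpMat.autMaxPlus n := ExpMat.autLe_le_autMaxPlus hn
  have e1 : ExpMat.autOdot n = ExpMat.autLe n :=
    le_antisymm (ExpMat.autOdot_le_autLe hn) fun φ hφ => (hmax hφ).1.1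
  have e2 : ExpMat.autOplus n = ExpMat.autLe n :=
    le_antisymm ExpMat.autOplus_le_autLe ExpMat.autLe_le_autOplus
  have e3 : ExpMat.autMaxPlus n = ExpMat.autLe n :=
    le_antisymm (fun φ hφ => ExpMat.autOplus_le_autLe hφ.1.2) hmax
  have hf := ExpMat.faithfulSMul hn
  have iso : Nonempty (ExpMat.autLe n ≃* Equiv.Perm (Fin n) × Multiplicative (ZMod 2)) := by
    rw [← ExpMat.range_toPermHom hn]
    exact ⟨(MonoidHom.ofInjective MulAction.toPerm_injective).symm⟩
  rw [e1, e2, e3]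
  exact ⟨rfl, rfl, rfl, hf, ExpMat.range_toPermHom hn, iso, iso, iso, iso⟩
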